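/- Let $K:\mathbb{R}\to\mathbb{R}$ be a kernel of some order $\ell\ge 1$, i.e. $u^jK(u)\in L_1(\mathbb{R})$ for $0\le j\le \ell$, $\int K(u)\,du=1$, $\int u^jK(u)\,du=0$ for $1\le j\le \ell-1$, and $\int u^\ell K(u)\,du\neq 0$. For $h>0$ put $K_h(u)=h^{-1}K(h^{-1}u)$. Let $X_1,X_2,\dots$ be iid real random variables with Lebesgue density $f$ and distribution function $F$. Let $F_n(x)=\frac1n\#\{i\le n: X_i\le x\}$ be the empirical distribution function of $X_1,\dots,X_n$, and put $$\hat f_h(x)=\frac1n\sum_{i=1}^n K_h(x-X_i),\qquad \hat F_n^h(x)=\int_{-\infty}^x\hat f_h(t)\,dt .$$ Let $d$ be either the Kolmogorov distance $d_\infty(G,H)=\sup_{x}|G(x)-H(x)|$ or, for some integer $k\ge1$, the Kuiper distance $$d_{kuip,k}(G,H)=\sup_{a_1\le b_1\le a_2\le b_2\le\dots\le a_k\le b_k}\ \sum_{i=1}^k\bigl|(G(b_i)-G(a_i))-(H(b_i)-H(a_i))\bigr| .$$ Let $s:\mathbb{N}\to(0,\infty)$ and $0<\varepsilon<1/2$ be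 such that $n^\varepsilon s(n)\to0$ as $n\to\infty$, and suppose that there are constants $c,h_0>0$ with $$d_\infty(F,F*K_h)\ \ge\ c\,h^\varepsilon\qquad\text{for all } 0<h<h_0 .$$ For each $n$ let $h_{s,n}$ be a (sample-dependent) bandwidth such that, almost surely, for all sufficiently large $n$, $h_{s,n}>0$ and $h_{s,n}$ is a solution $h$ of $d(F_n,\hat F_n^{h})=s(n)$; if there are several solutions, any choice is allowed. Then: 1. $n\,h_{s,n}\to0$ with probability $1$. 2. If in addition $K$ is compactly supported and $a,b>0$ are such that $\lambda\{x: f(x)\ge b\}\ge a$, where $\lambda$ is Lebesgue measure on $\mathbb{R}$, then $$\liminf_{n\to\infty}\|\hat f_{h_{s,n}}-f\|_1\ \ge\ ab\ >\ 0\qquad\text{with probability }1.$$ -/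

import Mathlib

open MeasureTheory ProbabilityTheory Filter Topology Set

/-- `K` is a kernel of order `ℓ`: `u ^ j * K u` is integrable for `j ≤ ℓ`, the integral of `K` is
`1`, the moments of orders `1, …, ℓ - 1` vanish and the moment of order `ℓ` does not vanish. -/
structure IsKernelOfOrder (K : ℝ → ℝ) (ℓ : ℕ) : Prop where
  order_pos : 1 ≤ ℓ
  integrable_moment : ∀ j ≤ ℓ, Integrable (fun u : ℝ => u ^ j * K u) volume
  integral_eq_one : ∫ u, K u = 1
  moment_eq_zero : ∀ j, 1 ≤ j → j < ℓ → ∫ u, u ^ j * K u = 0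
  moment_ne_zero : ∫ u, u ^ ℓ * K u ≠ 0

/-- The rescaled kernel `K_h(u) = h⁻¹ K(h⁻¹ u)`. -/
noncomputable def scaledKernel (K : ℝ → ℝ) (h : ℝ) : ℝ → ℝ :=
  fun u => h⁻¹ * K (h⁻¹ * u)

/-- The empirical distribution function of the real sample points `x 0, …, x (n - 1)`. -/
noncomputable def empiricalCDF (x : ℕ → ℝ) (n : ℕ) : ℝ → ℝ :=
  fun t => (n : ℝ)⁻¹ * ∑ i ∈ Finset.range n, (Iic t).indicator (fun _ => (1 : ℝ)) (x i)

/-- The kernel density estimator with bandwidth `h` of the sample points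
`x 0, …, x (n - 1)`. -/
noncomputable def kernelDensityEstimator (K : ℝ → ℝ) (x : ℕ → ℝ) (n : ℕ) (h : ℝ) : ℝ → ℝ :=
  fun t => (n : ℝ)⁻¹ * ∑ i ∈ Finset.range n, scaledKernel K h (t - x i)

/-- The kernel estimator of the distribution function: the primitive, from `-∞`, of the kernel
density estimator. -/
noncomputable def kernelCDFEstimator (K : ℝ → ℝ) (x : ℕ → ℝ) (n : ℕ) (h : ℝ) : ℝ → ℝ :=
  fun t => ∫ u in Iic t, kernelDensityEstimator K x n h u

/-- The smoothed distribution function `F_h = F ∗ K_h`. -/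
noncomputable def smoothedCDF (F K : ℝ → ℝ) (h : ℝ) : ℝ → ℝ :=
  convolution F (scaledKernel K h) (ContinuousLinearMap.mul ℝ ℝ) volume

/-- The Kolmogorov distance `‖F - G‖_∞` (for functions with a bounded difference). -/
noncomputable def kolmogorovDist (F G : ℝ → ℝ) : ℝ :=
  ⨆ x : ℝ, |F x - G x|

/-- The Kuiper distance of order `k` (for functions with a bounded difference): the supremum over
all `a₁ ≤ b₁ ≤ a₂ ≤ b₂ ≤ … ≤ a_k ≤ b_k` of
`∑ i, |(F (b i) - F (a i)) - (G (b i) - G (a i))|`. -/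
noncomputable def kuiperDist (k : ℕ) (F G : ℝ → ℝ) : ℝ :=
  sSup {r : ℝ | ∃ a b : Fin k → ℝ, (∀ i, a i ≤ b i) ∧ (∀ i j, i < j → b i ≤ a j) ∧
    r = ∑ i, |(F (b i) - F (a i)) - (G (b i) - G (a i))|}

/-- The distances allowed in the discrepancy principle: the Kolmogorov distance and the Kuiper
distances of all orders `k ≥ 1`. -/
def IsDiscrepancyDist (d : (ℝ → ℝ) → (ℝ → ℝ) → ℝ) : Prop :=
  d = kolmogorovDist ∨ ∃ k : ℕ, 1 ≤ k ∧ d = kuiperDist k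

/-- The bandwidth `h > 0` is chosen by the discrepancy principle with distance `d` and threshold
`s`: it solves `d(F_n, F̂_n^h) = s`. -/
def SolvesDiscrepancy (d : (ℝ → ℝ) → (ℝ → ℝ) → ℝ) (K : ℝ → ℝ) (x : ℕ → ℝ) (n : ℕ)
    (s h : ℝ) : Prop :=
  0 < h ∧ d (empiricalCDF x n) (kernelCDFEstimator K x n h) = s

/-! The discrepancy equation forces a small bias. Since `F̂_n^h = F_n ∗ K_h`, the bias `F - F ∗ K_h`
splits into `F - F_n`, `F_n - F̂_n^h` and `(F_n - F) ∗ K_h`, so its sup norm is at most `(1 + ‖K‖₁)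
‖F_n - F‖_∞ + s(n)`; Kuiper distances are covered because they dominate the Kolmogorov distance
here. Almost surely `‖F_n - F‖_∞ ≤ 2 n^(-γ)` eventually, for any `γ < 1/2`
(`ae_eventually_abs_empiricalCDF_sub_le`). With `ε < γ` the bias is `o(n^(-ε))`, and the lower bound
`c h^ε` yields `n h → 0`.

That lower bound is assumed only for `h < h₀`, so larger bandwidths must be excluded
(`IsKernelOfOrder.exists_forall_le_abs_sub_smoothedCDF`). If `F ∗ K_h = F`, the Fourier transform of
`K` would be 1 near 0, against the nonzero moment of order `ℓ`. Continuity in `h` makes the bias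
bounded below on compact ranges, and for `h → ∞` the smoothed function flattens out while `F` does
not.

For the second claim, the estimator vanishes off `n` intervals of total length `O(n h) → 0`, so the
error is at least `b` on almost all of `{f ≥ b}`. -/

/-! ### Rescaled kernels and smoothing. -/

lemma IsKernelOfOrder.integrable {K : ℝ → ℝ} {ℓ : ℕ} (hK : IsKernelOfOrder K ℓ) :
    Integrable K volume := by
  simpa using hK.integrable_moment 0 (Nat.zero_le _)

lemma integrable_scaledKernel {K : ℝ → ℝ} (hK : Integrable K volume) {h : ℝ} (hh : h ≠ 0) :
    Integrable (scaledKernel K h) volume :=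
  (hK.comp_mul_left' (inv_ne_zero hh)).const_mul _

lemma integral_mul_scaledKernel (K φ : ℝ → ℝ) {h : ℝ} (hh : 0 < h) :
    ∫ v, φ v * scaledKernel K h v = ∫ u, φ (h * u) * K u := by
  have h1 := Measure.integral_comp_inv_mul_left (fun u => φ (h * u) * K u) h
  simp only [mul_inv_cancel_left₀ hh.ne', abs_of_pos hh, smul_eq_mul] at h1
  rw [← mul_right_inj' hh.ne', ← h1, ← integral_const_mul]
  congr 1 with v
  simp only [scaledKernel]
  field_simp

lemma integral_abs_scaledKernel (K : ℝ → ℝ) {h : ℝ} (hh : 0 < h) :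
    ∫ v, |scaledKernel K h v| = ∫ u, |K u| := by
  have h1 := integral_mul_scaledKernel (fun u => |K u|) (fun _ => 1) hh
  simp only [one_mul] at h1
  rw [← h1]
  congr 1 with v
  simp [scaledKernel, abs_mul, abs_of_pos hh]

lemma smoothedCDF_eq (F K : ℝ → ℝ) (h t : ℝ) :
    smoothedCDF F K h t = ∫ v, F (t - v) * scaledKernel K h v := by
  rw [smoothedCDF, convolution_def,
    ← integral_sub_left_eq_self (fun v => F (t - v) * scaledKernel K h v) volume t]
  simp

lemma smoothedCDF_eq_integral_kernel (F K : ℝ → ℝ) {h : ℝ} (hh : 0 < h) (t : ℝ) :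
    smoothedCDF F K h t = ∫ u, F (t - h * u) * K u := by
  rw [smoothedCDF_eq, integral_mul_scaledKernel K (fun v => F (t - v)) hh]

/-! ### The estimator as a smoothed empirical distribution function. -/

lemma measurable_empiricalCDF (x : ℕ → ℝ) (n : ℕ) : Measurable (empiricalCDF x n) := by
  unfold empiricalCDF
  refine (Finset.measurable_sum _ fun i _ => ?_).const_mul _
  have : (fun t : ℝ => (Iic t).indicator (fun _ => (1 : ℝ)) (x i)) =
      (Ici (x i)).indicator fun _ => 1 := by
    ext t; simp [indicator]
  rw [this]
  exact measurable_const.indicator measurableSet_Ici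

lemma empiricalCDF_mem_Icc (x : ℕ → ℝ) (n : ℕ) (t : ℝ) : empiricalCDF x n t ∈ Icc (0 : ℝ) 1 := by
  have h0 : ∀ i, 0 ≤ (Iic t).indicator (fun _ => (1 : ℝ)) (x i) := fun i =>
    indicator_nonneg (fun _ _ => zero_le_one) _
  refine ⟨mul_nonneg (by positivity) (Finset.sum_nonneg fun i _ => h0 i), ?_⟩
  have h1 : ∑ i ∈ Finset.range n, (Iic t).indicator (fun _ => (1 : ℝ)) (x i) ≤ n := by
    refine (Finset.sum_le_card_nsmul _ _ 1 fun i _ => ?_).trans (by simp)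
    exact indicator_le_self' (fun _ _ => zero_le_one) _
  rcases Nat.eq_zero_or_pos n with rfl | hn
  · simp [empiricalCDF]
  · rw [empiricalCDF, inv_mul_le_iff₀ (by positivity)]
    simpa using h1

lemma monotone_empiricalCDF (x : ℕ → ℝ) (n : ℕ) : Monotone (empiricalCDF x n) := by
  intro s t hst
  refine mul_le_mul_of_nonneg_left (Finset.sum_le_sum fun i _ => ?_) (by positivity)
  exact indicator_le_indicator_of_subset (Iic_subset_Iic.2 hst) (fun _ => zero_le_one) _

lemma integrable_kernelDensityEstimator {K : ℝ → ℝ} (hK : Integrable K volume) (x : ℕ → ℝ) (n : ℕ)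
    {h : ℝ} (hh : h ≠ 0) : Integrable (kernelDensityEstimator K x n h) volume :=
  (integrable_finsetSum _ fun i _ =>
    (integrable_scaledKernel hK hh).comp_sub_right (x i)).const_mul _

/-- Translating the `i`-th summand by `x i` moves the cutoff at `t` from the kernel to the
indicator. In this form the estimator can be compared with `F ∗ K_h` under one integral. -/
lemma kernelCDFEstimator_eq {K : ℝ → ℝ} (hK : Integrable K volume) (x : ℕ → ℝ) (n : ℕ)
    {h : ℝ} (hh : h ≠ 0) (t : ℝ) :
    kernelCDFEstimator K x n h t = ∫ v, empiricalCDF x n (t - v) * scaledKernel K h v := by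
  have hI := integrable_scaledKernel hK hh
  have h1 : ∀ i, ∫ u in Iic t, scaledKernel K h (u - x i) =
      ∫ v, (Iic (t - v)).indicator (fun _ => (1 : ℝ)) (x i) * scaledKernel K h v := by
    intro i
    rw [← integral_indicator measurableSet_Iic, ← integral_add_right_eq_self _ (x i)]
    congr 1 with v
    simp [indicator, le_sub_iff_add_le, add_comm]
  have h2 : ∀ i, Integrable (fun v => (Iic (t - v)).indicator (fun _ => (1 : ℝ)) (x i) *
      scaledKernel K h v) volume := by
    intro i
    have : (fun v => (Iic (t - v)).indicator (fun _ => (1 : ℝ)) (x i) * scaledKernel K h v) =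
        (Iic (t - x i)).indicator (scaledKernel K h) := by
      ext v
      simp [indicator, le_sub_comm]
    rw [this]
    exact hI.indicator measurableSet_Iic
  simp only [kernelCDFEstimator, kernelDensityEstimator, empiricalCDF]
  rw [integral_const_mul, integral_finsetSum _ fun i _ => (hI.comp_sub_right (x i)).integrableOn]
  simp only [h1, mul_assoc, Finset.sum_mul]
  rw [integral_const_mul, integral_finsetSum _ fun i _ => h2 i]

lemma integrable_comp_sub_mul {G k : ℝ → ℝ} (hG : Measurable G) {C : ℝ} (hb : ∀ t, |G t| ≤ C)
    (hk : Integrable k volume) (t : ℝ) : Integrable (fun v => G (t - v) * k v) volume :=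
  hk.bdd_mul (c := C) (hG.comp (measurable_const.sub measurable_id)).aestronglyMeasurable
    (ae_of_all _ fun _ => hb _)

/-- The bias of the smoothed distribution function is controlled by the uniform deviation of the
empirical distribution function and by the discrepancy of the kernel estimator. -/
lemma abs_sub_smoothedCDF_le {K : ℝ → ℝ} (hK : Integrable K volume) {F : ℝ → ℝ}
    (hF : Measurable F) (hF01 : ∀ t, F t ∈ Icc (0 : ℝ) 1) (x : ℕ → ℝ) (n : ℕ) {h D : ℝ}
    (hh : 0 < h) (hD : ∀ t, |empiricalCDF x n t - F t| ≤ D) (t : ℝ) :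
    |F t - smoothedCDF F K h t| ≤
      (1 + ∫ u, |K u|) * D + |empiricalCDF x n t - kernelCDFEstimator K x n h t| := by
  have hI := integrable_scaledKernel hK hh.ne'
  have habs : ∀ {a : ℝ}, a ∈ Icc (0 : ℝ) 1 → |a| ≤ 1 := fun ha => abs_le.2 ⟨by linarith [ha.1], ha.2⟩
  have h1 : |kernelCDFEstimator K x n h t - smoothedCDF F K h t| ≤ D * ∫ u, |K u| := by
    rw [kernelCDFEstimator_eq hK x n hh.ne', smoothedCDF_eq, ← integral_sub
      (integrable_comp_sub_mul (measurable_empiricalCDF x n)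
        (fun t => habs (empiricalCDF_mem_Icc x n t)) hI t)
      (integrable_comp_sub_mul hF (fun t => habs (hF01 t)) hI t),
      ← integral_abs_scaledKernel K hh, ← integral_const_mul]
    rw [← Real.norm_eq_abs]
    refine norm_integral_le_of_norm_le (hI.abs.const_mul D) (ae_of_all _ fun v => ?_)
    rw [← sub_mul, Real.norm_eq_abs, abs_mul]
    exact mul_le_mul_of_nonneg_right (hD _) (abs_nonneg _)
  have h2 := hD t
  rw [abs_sub_comm] at h2
  calc |F t - smoothedCDF F K h t|
      = |(F t - empiricalCDF x n t) + (empiricalCDF x n t - kernelCDFEstimator K x n h t) +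
        (kernelCDFEstimator K x n h t - smoothedCDF F K h t)| := by congr 1; ring
    _ ≤ _ := abs_add_three _ _ _
    _ ≤ _ := by linarith

/-! ### From the discrepancy to a uniform bound. -/

lemma abs_kernelCDFEstimator_le {K : ℝ → ℝ} (x : ℕ → ℝ) (n : ℕ) {h : ℝ}
    (hint : Integrable (kernelDensityEstimator K x n h) volume) (t : ℝ) :
    |kernelCDFEstimator K x n h t| ≤ ∫ u, |kernelDensityEstimator K x n h u| :=
  (abs_integral_le_integral_abs).trans
    (setIntegral_le_integral hint.abs (ae_of_all _ fun _ => abs_nonneg _))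

lemma tendsto_setIntegral_Iic_atBot {g : ℝ → ℝ} (hg : Integrable g volume) :
    Tendsto (fun t => ∫ u in Iic t, g u) atBot (𝓝 0) := by
  have h1 : Tendsto (fun t => (∫ u, g u) - ∫ u in Ioi t, g u) atBot (𝓝 0) := by
    have : Tendsto (fun t => ∫ u in Ioi t, g u) atBot (𝓝 (∫ u, g u)) := by
      have := (aecover_Ioi (μ := volume) (l := atBot) (a := fun t : ℝ => t)
        tendsto_id).integral_tendsto_of_countably_generated hg
      exact this
    simpa using this.const_sub (∫ u, g u)
  refine h1.congr fun t => ?_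
  rw [← integral_add_compl (measurableSet_Iic (a := t)) hg, compl_Iic]
  ring

lemma tendsto_empiricalCDF_atBot (x : ℕ → ℝ) (n : ℕ) :
    Tendsto (empiricalCDF x n) atBot (𝓝 0) := by
  refine tendsto_const_nhds.congr' ?_
  have : ∀ᶠ t in atBot, ∀ i ∈ Finset.range n, t < x i :=
    (Finset.eventually_all _).2 fun i _ => eventually_lt_atBot _
  filter_upwards [this] with t ht
  rw [empiricalCDF, Finset.sum_eq_zero, mul_zero]
  intro i hi
  simp [ht i hi]

/-- Take `[a, t]` as first interval, collapse all others to the point `t`, and let `a → -∞`.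
Boundedness matters: the real supremum of an unbounded set defaults to 0. -/
lemma abs_sub_le_kuiperDist {F G : ℝ → ℝ} {C : ℝ} (hb : ∀ t, |F t - G t| ≤ C)
    (hlim : Tendsto (fun t => F t - G t) atBot (𝓝 0)) {k : ℕ} (hk : 1 ≤ k) (t : ℝ) :
    |F t - G t| ≤ kuiperDist k F G := by
  have hbdd : BddAbove {r : ℝ | ∃ a b : Fin k → ℝ, (∀ i, a i ≤ b i) ∧ (∀ i j, i < j → b i ≤ a j) ∧
      r = ∑ i, |(F (b i) - F (a i)) - (G (b i) - G (a i))|} := by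
    refine ⟨k * (C + C), ?_⟩
    rintro r ⟨a, b, -, -, rfl⟩
    refine (Finset.sum_le_card_nsmul _ _ (C + C) fun i _ => ?_).trans (by simp [mul_add])
    calc _ = |(F (b i) - G (b i)) - (F (a i) - G (a i))| := by congr 1; ring
      _ ≤ _ := (abs_sub _ _).trans (add_le_add (hb _) (hb _))
  have h1 : ∀ a ≤ t, |(F t - G t) - (F a - G a)| ≤ kuiperDist k F G := by
    intro a ha
    let i₀ : Fin k := ⟨0, hk⟩
    have hmem : ∑ i : Fin k, |(F t - F (if i = i₀ then a else t)) -
        (G t - G (if i = i₀ then a else t))| ≤ kuiperDist k F G := by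
      refine le_csSup hbdd ⟨fun i => if i = i₀ then a else t, fun _ => t, fun i => ?_,
        fun i j hij => ?_, rfl⟩
      · dsimp only; split_ifs <;> simp [ha]
      · have : j ≠ i₀ := by
          rintro rfl
          exact absurd hij (by simp [i₀, Fin.lt_def])
        simp [this]
    refine le_trans ?_ hmem
    refine le_trans (le_of_eq ?_) (Finset.single_le_sum (fun i _ => abs_nonneg _)
      (Finset.mem_univ i₀))
    simp only [if_true]
    congr 1
    ring
  have h2 : Tendsto (fun a => |(F t - G t) - (F a - G a)|) atBot (𝓝 |F t - G t|) := by
    simpa using (hlim.const_sub (F t - G t)).abs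
  exact le_of_tendsto h2 ((eventually_le_atBot t).mono h1)

lemma IsDiscrepancyDist.abs_sub_le {d : (ℝ → ℝ) → (ℝ → ℝ) → ℝ} (hd : IsDiscrepancyDist d)
    {F G : ℝ → ℝ} {C : ℝ} (hb : ∀ t, |F t - G t| ≤ C)
    (hlim : Tendsto (fun t => F t - G t) atBot (𝓝 0)) (t : ℝ) : |F t - G t| ≤ d F G := by
  rcases hd with rfl | ⟨k, hk, rfl⟩
  · exact le_ciSup (f := fun x => |F x - G x|) ⟨C, by rintro _ ⟨s, rfl⟩; exact hb s⟩ t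
  · exact abs_sub_le_kuiperDist hb hlim hk t

/-- A solution of the discrepancy principle has a small bias. -/
lemma SolvesDiscrepancy.abs_sub_smoothedCDF_le {d : (ℝ → ℝ) → (ℝ → ℝ) → ℝ}
    (hd : IsDiscrepancyDist d) {K : ℝ → ℝ} (hK : Integrable K volume) {F : ℝ → ℝ}
    (hF : Measurable F) (hF01 : ∀ t, F t ∈ Icc (0 : ℝ) 1) {x : ℕ → ℝ} {n : ℕ} {s h D : ℝ}
    (hsol : SolvesDiscrepancy d K x n s h) (hD : ∀ t, |empiricalCDF x n t - F t| ≤ D) (t : ℝ) :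
    |F t - smoothedCDF F K h t| ≤ (1 + ∫ u, |K u|) * D + s := by
  obtain ⟨hh, rfl⟩ := hsol
  have hint := integrable_kernelDensityEstimator hK x n hh.ne'
  refine (_root_.abs_sub_smoothedCDF_le hK hF hF01 x n hh hD t).trans ?_
  gcongr
  refine hd.abs_sub_le (C := 1 + ∫ u, |kernelDensityEstimator K x n h u|) (fun t => ?_) ?_ t
  · refine (abs_sub _ _).trans (add_le_add ?_ (abs_kernelCDFEstimator_le x n hint t))
    have := empiricalCDF_mem_Icc x n t
    exact abs_le.2 ⟨by linarith [this.1], this.2⟩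
  · simpa [kernelCDFEstimator] using (tendsto_empiricalCDF_atBot x n).sub (tendsto_setIntegral_Iic_atBot hint)

/-! ### Fourier argument: smoothing never fixes `F`. -/

open scoped FourierTransform Convolution

/-- Half-lines form a π-system generating the Borel sets; the vanishing total integral handles
complements. -/
lemma ae_eq_zero_of_forall_setIntegral_Iic_eq_zero {g : ℝ → ℝ} (hg : Integrable g volume)
    (hzero : ∀ x, ∫ t in Iic x, g t = 0) : g =ᵐ[volume] 0 := by
  have htot : ∫ t, g t = 0 := by
    refine tendsto_nhds_unique ((aecover_Iic (μ := volume) (l := atTop) (b := fun t : ℝ => t)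
      tendsto_id).integral_tendsto_of_countably_generated hg) ?_
    simp [hzero]
  refine hg.ae_eq_of_forall_setIntegral_eq _ _ (integrable_zero _ _ _) fun s hs hlt => ?_
  clear hlt
  simp only [Pi.zero_apply, integral_zero]
  induction s, hs using MeasurableSpace.induction_on_inter
    (borel_eq_generateFrom_Iic ℝ ▸ BorelSpace.measurable_eq) isPiSystem_Iic with
  | empty => simp
  | basic t ht => obtain ⟨x, rfl⟩ := ht; exact hzero x
  | compl t ht ih =>
    have := integral_add_compl ht hg
    linarith
  | iUnion t hd hm ih =>
    rw [integral_iUnion hm hd hg.integrableOn]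
    simp [ih]

lemma fourier_ofReal_scaledKernel (K : ℝ → ℝ) {h : ℝ} (hh : 0 < h) (ξ : ℝ) :
    𝓕 (fun v => (scaledKernel K h v : ℂ)) ξ = 𝓕 (fun u => (K u : ℂ)) (h * ξ) := by
  rw [Real.fourier_real_eq_integral_exp_smul, Real.fourier_real_eq_integral_exp_smul]
  have h1 := Measure.integral_comp_inv_mul_left
    (fun u => Complex.exp (↑(-2 * Real.pi * u * (h * ξ)) * Complex.I) • (K u : ℂ)) h
  rw [abs_of_pos hh, ← inv_smul_eq_iff₀ hh.ne', ← integral_smul] at h1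
  rw [← h1]
  congr 1 with v
  rw [show -2 * Real.pi * (h⁻¹ * v) * (h * ξ) = -2 * Real.pi * v * ξ by field_simp]
  simp only [scaledKernel, smul_eq_mul, Complex.real_smul]
  push_cast
  ring

/-- The Fourier transform of a kernel of finite order is not constant near the origin. -/
lemma IsKernelOfOrder.not_eventually_fourier_eq_one {K : ℝ → ℝ} {ℓ : ℕ}
    (hK : IsKernelOfOrder K ℓ) : ¬ ∀ᶠ ξ in 𝓝 (0 : ℝ), 𝓕 (fun u => (K u : ℂ)) ξ = 1 := by
  intro hone
  have hint : ∀ n : ℕ, (n : ℕ∞) ≤ ℓ → Integrable (fun u : ℝ => u ^ n • (K u : ℂ)) := by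
    intro n hn
    have := (hK.integrable_moment n (by exact_mod_cast hn)).ofReal (𝕜 := ℂ)
    simpa using this
  -- The `ℓ`-th derivative at 0 is `(-2πi)^ℓ` times the `ℓ`-th moment, yet it vanishes for a
  -- function locally constant at 0, as `ℓ ≥ 1`.
  have h1 := congrFun (Real.iteratedDeriv_fourier hint le_rfl) 0
  have h2 : iteratedDeriv ℓ (𝓕 (fun u => (K u : ℂ))) 0 = 0 := by
    have : (𝓕 (fun u => (K u : ℂ))) =ᶠ[𝓝 0] fun _ => 1 := hone
    rw [this.iteratedDeriv_eq, iteratedDeriv_const, if_neg (by have := hK.order_pos; omega)]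
  rw [h2, Real.fourier_real_eq_integral_exp_smul] at h1
  have h3 : (-2 * Real.pi * Complex.I : ℂ) ^ ℓ * ((∫ u, u ^ ℓ * K u : ℝ) : ℂ) = 0 := by
    rw [h1, ← integral_complex_ofReal, ← integral_const_mul]
    congr 1 with u
    simp
    ring
  rcases mul_eq_zero.1 h3 with h4 | h4
  · exact absurd h4 (by simp [Real.pi_ne_zero])
  · exact hK.moment_ne_zero (by exact_mod_cast h4)

/-- Fubini; this transfers `F = F ∗ K_h` to the densities. -/
lemma setIntegral_Iic_convolution {f k : ℝ → ℝ} (hf : Integrable f volume)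
    (hk : Integrable k volume) (x : ℝ) :
    ∫ t in Iic x, ∫ v, f (t - v) * k v = ∫ v, (∫ t in Iic (x - v), f t) * k v := by
  have hprod := hk.convolution_integrand (ContinuousLinearMap.mul ℝ ℝ).flip hf
  simp only [ContinuousLinearMap.flip_apply, ContinuousLinearMap.mul_apply'] at hprod
  rw [integral_integral_swap (μ := volume.restrict (Iic x)) (ν := volume)
    (f := fun t v => f (t - v) * k v)]
  · congr 1 with v
    rw [integral_mul_const]
    congr 1
    rw [← integral_indicator measurableSet_Iic, ← integral_indicator measurableSet_Iic,
      ← integral_add_right_eq_self _ v]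
    congr 1 with t
    simp [indicator, le_sub_iff_add_le]
  · refine hprod.mono_measure ?_
    exact Measure.prod_mono Measure.restrict_le_self le_rfl

/-- Smoothing by a kernel of finite order changes every distribution function with a density. -/
lemma IsKernelOfOrder.exists_ne_smoothedCDF {K : ℝ → ℝ} {ℓ : ℕ} (hK : IsKernelOfOrder K ℓ)
    {f : ℝ → ℝ} (hf : Integrable f volume) (hf1 : ∫ t, f t = 1) {F : ℝ → ℝ}
    (hF : ∀ x, F x = ∫ t in Iic x, f t) {h : ℝ} (hh : 0 < h) :
    ∃ x, F x ≠ smoothedCDF F K h x := by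
  by_contra! hcon
  have hI := integrable_scaledKernel hK.integrable hh.ne'
  have hprod := hI.convolution_integrand (ContinuousLinearMap.mul ℝ ℝ).flip hf
  simp only [ContinuousLinearMap.flip_apply, ContinuousLinearMap.mul_apply'] at hprod
  have hconv : Integrable (fun t => ∫ v, f (t - v) * scaledKernel K h v) volume :=
    hprod.integral_prod_left
  have hae : (fun t => f t - ∫ v, f (t - v) * scaledKernel K h v) =ᵐ[volume] 0 := by
    refine ae_eq_zero_of_forall_setIntegral_Iic_eq_zero (hf.sub hconv) fun x => ?_
    rw [integral_sub hf.integrableOn hconv.integrableOn, setIntegral_Iic_convolution hf hI,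
      ← hF, hcon x, smoothedCDF_eq]
    simp [hF]
  have hfour : ∀ ξ, 𝓕 (fun t => (f t : ℂ)) ξ =
      𝓕 (fun t => (f t : ℂ)) ξ * 𝓕 (fun u => (K u : ℂ)) (h * ξ) := by
    intro ξ
    have hmul := Real.fourier_mul_convolution_eq (hf.ofReal (𝕜 := ℂ)) (hI.ofReal (𝕜 := ℂ)) ξ
    simp only [Complex.coe_algebraMap] at hmul
    rw [← fourier_ofReal_scaledKernel K hh, ← hmul,
      Real.fourier_real_eq_integral_exp_smul, Real.fourier_real_eq_integral_exp_smul]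
    refine integral_congr_ae ?_
    filter_upwards [hae] with t ht
    congr 1
    rw [← convolution_flip, convolution_def]
    have h1 : f t = ∫ v, f (t - v) * scaledKernel K h v := sub_eq_zero.1 ht
    rw [h1, ← integral_complex_ofReal]
    congr 1 with v
    simp [mul_comm]
  have hcont : ∀ {g : ℝ → ℝ}, Integrable g volume → Continuous (𝓕 (fun t => (g t : ℂ))) :=
    fun hg => VectorFourier.fourierIntegral_continuous Real.continuous_fourierChar
      continuous_inner hg.ofReal
  -- The transform of `f` is 1 at 0, hence nonzero nearby, where it can be cancelled from `hfour`.
  have h0 : 𝓕 (fun t => (f t : ℂ)) 0 ≠ 0 := by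
    rw [Real.fourier_real_eq_integral_exp_smul]
    simp [integral_complex_ofReal, hf1]
  refine hK.not_eventually_fourier_eq_one ?_
  have h1 : ∀ᶠ ξ in 𝓝 (0 : ℝ), 𝓕 (fun t => (f t : ℂ)) ξ ≠ 0 := (hcont hf).continuousAt.eventually_ne h0
  have h2 : Tendsto (fun ξ : ℝ => h⁻¹ * ξ) (𝓝 0) (𝓝 0) := by
    simpa using (continuous_const_mul h⁻¹).tendsto (0 : ℝ)
  filter_upwards [h2.eventually h1] with ξ hξ
  have := hfour (h⁻¹ * ξ)
  rw [mul_inv_cancel_left₀ hh.ne'] at this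
  exact mul_left_cancel₀ hξ (by rw [← this, mul_one])

/-! ### Bias for bandwidths away from zero. -/

lemma continuousAt_smoothedCDF {K : ℝ → ℝ} (hK : Integrable K volume) {F : ℝ → ℝ}
    (hF : Continuous F) {C : ℝ} (hb : ∀ t, |F t| ≤ C) (x : ℝ) {h : ℝ} (hh : 0 < h) :
    ContinuousAt (fun h => smoothedCDF F K h x) h := by
  have h1 : ContinuousAt (fun h => ∫ u, F (x - h * u) * K u) h := by
    refine continuousAt_of_dominated (bound := fun u => C * |K u|) ?_ ?_ (hK.abs.const_mul C) ?_
    · exact Eventually.of_forall fun h =>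
        (hF.comp (by fun_prop : Continuous fun u => x - h * u)).aestronglyMeasurable.mul
          hK.aestronglyMeasurable
    · refine Eventually.of_forall fun h => ae_of_all _ fun u => ?_
      rw [Real.norm_eq_abs, abs_mul]
      exact mul_le_mul_of_nonneg_right (hb _) (abs_nonneg _)
    · exact ae_of_all _ fun u => by fun_prop
  refine h1.congr ?_
  filter_upwards [eventually_gt_nhds hh] with h hh
  exact (smoothedCDF_eq_integral_kernel F K hh x).symm

/-- Dominated convergence, as `F (x - h u)` tends to 1 for `u < 0` and to 0 for `u > 0`. What
matters is that the limit does not depend on `x`. -/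
lemma tendsto_smoothedCDF_atTop {K : ℝ → ℝ} (hK : Integrable K volume) {F : ℝ → ℝ}
    (hF : Continuous F) {C : ℝ} (hb : ∀ t, |F t| ≤ C) (hbot : Tendsto F atBot (𝓝 0))
    (htop : Tendsto F atTop (𝓝 1)) (x : ℝ) :
    Tendsto (fun h => smoothedCDF F K h x) atTop (𝓝 (∫ u in Iio 0, K u)) := by
  have h1 : Tendsto (fun h => ∫ u, F (x - h * u) * K u) atTop
      (𝓝 (∫ u, (Iio 0).indicator K u)) := by
    refine tendsto_integral_filter_of_dominated_convergence (fun u => C * |K u|) ?_ ?_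
      (hK.abs.const_mul C) ?_
    · exact Eventually.of_forall fun h =>
        (hF.comp (by fun_prop : Continuous fun u => x - h * u)).aestronglyMeasurable.mul
          hK.aestronglyMeasurable
    · refine Eventually.of_forall fun h => ae_of_all _ fun u => ?_
      rw [Real.norm_eq_abs, abs_mul]
      exact mul_le_mul_of_nonneg_right (hb _) (abs_nonneg _)
    · filter_upwards [compl_mem_ae_iff.2 (measure_singleton (0 : ℝ))] with u hu
      rcases lt_or_gt_of_ne (show u ≠ 0 from hu) with hneg | hpos
      · have : Tendsto (fun h => x - h * u) atTop atTop := by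
          have := (tendsto_id (α := ℝ) (x := atTop)).atTop_mul_const (neg_pos.2 hneg)
          simpa [sub_eq_add_neg] using tendsto_atTop_add_const_left _ x this
        simpa [hneg] using (htop.comp this).mul_const (K u)
      · have : Tendsto (fun h => x - h * u) atTop atBot := by
          have := (tendsto_id (α := ℝ) (x := atTop)).atTop_mul_const_of_neg (neg_lt_zero.2 hpos)
          simpa [sub_eq_add_neg] using tendsto_atBot_add_const_left _ x this
        simpa [hpos.le] using (hbot.comp this).mul_const (K u)
  rw [integral_indicator measurableSet_Iio] at h1
  refine h1.congr' ?_
  filter_upwards [eventually_gt_atTop 0] with h hh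
  exact (smoothedCDF_eq_integral_kernel F K hh x).symm

/-- The bias is bounded away from zero for bandwidths bounded away from zero. -/
lemma IsKernelOfOrder.exists_forall_le_abs_sub_smoothedCDF {K : ℝ → ℝ} {ℓ : ℕ}
    (hK : IsKernelOfOrder K ℓ) {f : ℝ → ℝ} (hf : Integrable f volume) (hf1 : ∫ t, f t = 1)
    {F : ℝ → ℝ} (hF : ∀ x, F x = ∫ t in Iic x, f t) (hFc : Continuous F)
    (hF01 : ∀ t, F t ∈ Icc (0 : ℝ) 1) (hbot : Tendsto F atBot (𝓝 0))
    (htop : Tendsto F atTop (𝓝 1)) {h₀ : ℝ} (hh₀ : 0 < h₀) :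
    ∃ δ > 0, ∀ h, h₀ ≤ h → ∃ x, δ ≤ |F x - smoothedCDF F K h x| := by
  have hb : ∀ t, |F t| ≤ 1 := fun t => abs_le.2 ⟨by linarith [(hF01 t).1], (hF01 t).2⟩
  have hfar : ∃ H, ∀ h, H ≤ h → ∃ x, 1 / 8 ≤ |F x - smoothedCDF F K h x| := by
    -- `F` rises by more than 1/2 from `x` to `y`, the smoothed function eventually changes by less
    -- than 1/4, so the bias is at least 1/8 at one of them.
    obtain ⟨x, hx⟩ := (hbot.eventually_lt_const (show (0 : ℝ) < 1 / 4 by norm_num)).exists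
    obtain ⟨y, hy⟩ := (htop.eventually_const_lt (show (3 / 4 : ℝ) < 1 by norm_num)).exists
    have hlim := (tendsto_smoothedCDF_atTop hK.integrable hFc hb hbot htop x).sub
      (tendsto_smoothedCDF_atTop hK.integrable hFc hb hbot htop y)
    rw [sub_self] at hlim
    obtain ⟨H, hH⟩ := eventually_atTop.1
      (hlim.eventually (Metric.ball_mem_nhds (0 : ℝ) (show (0 : ℝ) < 1 / 4 by norm_num)))
    refine ⟨H, fun h hh => ?_⟩
    have h1 := hH h hh
    rw [dist_zero_right, Real.norm_eq_abs, abs_lt] at h1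
    by_contra! hcon
    have h2 := abs_lt.1 (hcon x)
    have h3 := abs_lt.1 (hcon y)
    linarith [h1.1, h1.2, h2.1, h2.2, h3.1, h3.2]
  obtain ⟨H, hH⟩ := hfar
  have hnear : ∃ δ > 0, ∀ h ∈ Icc h₀ H, ∃ x, δ ≤ |F x - smoothedCDF F K h x| := by
    refine isCompact_Icc.induction_on
      (p := fun s => ∃ δ > 0, ∀ h ∈ s, ∃ x, δ ≤ |F x - smoothedCDF F K h x|) ⟨1, one_pos, by simp⟩
      ?_ ?_ ?_
    · rintro s t hst ⟨δ, hδ, h1⟩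
      exact ⟨δ, hδ, fun h hh => h1 h (hst hh)⟩
    · rintro s t ⟨δ, hδ, h1⟩ ⟨δ', hδ', h2⟩
      refine ⟨min δ δ', lt_min hδ hδ', fun h hh => ?_⟩
      rcases hh with hh | hh
      · obtain ⟨x, hx⟩ := h1 h hh
        exact ⟨x, (min_le_left _ _).trans hx⟩
      · obtain ⟨x, hx⟩ := h2 h hh
        exact ⟨x, (min_le_right _ _).trans hx⟩
    · intro h hh
      have hpos : 0 < h := hh₀.trans_le hh.1
      obtain ⟨x, hx⟩ := hK.exists_ne_smoothedCDF hf hf1 hF hpos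
      have hx' : 0 < |F x - smoothedCDF F K h x| := abs_pos.2 (sub_ne_zero.2 hx)
      have hc : ContinuousAt (fun h => |F x - smoothedCDF F K h x|) h :=
        (continuousAt_const.sub (continuousAt_smoothedCDF hK.integrable hFc hb x hpos)).abs
      refine ⟨_, mem_nhdsWithin_of_mem_nhds (hc.eventually_const_lt (half_lt_self hx')), _,
        half_pos hx', fun h' hh' => ⟨x, le_of_lt hh'⟩⟩
  obtain ⟨δ, hδ, h1⟩ := hnear
  refine ⟨min δ (1 / 8), lt_min hδ (by norm_num), fun h hh => ?_⟩
  rcases le_total H h with hHh | hHh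
  · obtain ⟨x, hx⟩ := hH h hHh
    exact ⟨x, (min_le_right _ _).trans hx⟩
  · obtain ⟨x, hx⟩ := h1 h ⟨hh, hHh⟩
    exact ⟨x, (min_le_left _ _).trans hx⟩

/-! ### Uniform deviation of the empirical distribution function. -/

/-- Monotonicity between neighbouring quantiles costs at most `1 / m`. Levels 0 and 1 may not be
attained, so they are left out; there the bounds 0 and 1 on `G` suffice. -/
lemma abs_sub_le_of_forall_grid {F G : ℝ → ℝ} (hF : Monotone F) (hG : Monotone G)
    (hF01 : ∀ t, F t ∈ Icc (0 : ℝ) 1) (hG01 : ∀ t, G t ∈ Icc (0 : ℝ) 1) {m : ℕ} (hm : 0 < m)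
    {q : ℕ → ℝ} (hq : ∀ j, 0 < j → j < m → F (q j) = j / m) {δ : ℝ} (hδ : 0 ≤ δ)
    (hgrid : ∀ j, 0 < j → j < m → |G (q j) - F (q j)| ≤ δ) (x : ℝ) :
    |G x - F x| ≤ δ + 1 / m := by
  have hm' : (0 : ℝ) < m := by exact_mod_cast hm
  have hmF : 0 ≤ F x * m := mul_nonneg (hF01 x).1 hm'.le
  rw [abs_le]
  constructor
  · rcases Nat.lt_or_ge 1 ⌈F x * m⌉₊ with hi | hi
    · obtain ⟨i, hi'⟩ : ∃ i, ⌈F x * m⌉₊ = i + 1 := ⟨_, (Nat.succ_pred_eq_of_pos (by omega)).symm⟩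
      have h1 : (i : ℝ) < F x * m := Nat.lt_ceil.1 (by omega)
      have h2 : F x * m ≤ i + 1 := by exact_mod_cast hi' ▸ Nat.le_ceil (F x * m)
      have him : i < m := by
        have : F x * m ≤ m := mul_le_of_le_one_left hm'.le (hF01 x).2
        exact_mod_cast h1.trans_le this
      have hqi := hq i (by omega) him
      have h3 : q i ≤ x := by
        by_contra! hlt
        have := hF hlt.le
        rw [hqi, le_div_iff₀ hm'] at this
        linarith
      have h4 := abs_le.1 (hgrid i (by omega) him)
      have h5 : F x ≤ i / m + 1 / m := by
        rw [← add_div, le_div_iff₀ hm']; exact h2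
      linarith [hG h3, h4.1]
    · have h2 : F x * m ≤ 1 := (Nat.le_ceil _).trans (by exact_mod_cast hi)
      rw [← le_div_iff₀ hm'] at h2
      linarith [(hG01 x).1]
  · have h1 : F x * m < ⌊F x * m⌋₊ + 1 := Nat.lt_floor_add_one _
    have h2 : (⌊F x * m⌋₊ : ℝ) ≤ F x * m := Nat.floor_le hmF
    set j := ⌊F x * m⌋₊
    have h5 : (j : ℝ) / m ≤ F x := by rwa [div_le_iff₀ hm']
    rcases Nat.lt_or_ge (j + 1) m with hj | hj
    · have hqj := hq (j + 1) (by omega) hj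
      push_cast at hqj
      have h3 : x ≤ q (j + 1) := by
        by_contra! hlt
        have := hF hlt.le
        rw [hqj, div_le_iff₀ hm'] at this
        linarith
      have h4 := abs_le.1 (hgrid (j + 1) (by omega) hj)
      rw [add_div] at hqj
      linarith [hG h3, h4.2]
    · have h3 : (1 : ℝ) ≤ j / m + 1 / m := by
        rw [← add_div, one_le_div hm']; exact_mod_cast hj
      linarith [(hG01 x).2]

lemma summable_nat_mul_exp_neg_rpow {β : ℝ} (hβ : 0 < β) :
    Summable fun n : ℕ => (n : ℝ) * (2 * Real.exp (-2 * (n : ℝ) ^ β)) := by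
  -- The power `-3 / β` of `n ^ β` is `n ^ (-3)`, so the terms are `O(n ^ (-2))`.
  have h1 := (isLittleO_exp_neg_mul_rpow_atTop (a := 2) two_pos (-3 / β)).isBigO.comp_tendsto
    ((tendsto_rpow_atTop hβ).comp tendsto_natCast_atTop_atTop)
  have h2 := (Asymptotics.isBigO_refl (fun n : ℕ => (n : ℝ)) atTop).mul (h1.const_mul_left 2)
  refine summable_of_isBigO_nat (Real.summable_nat_rpow.2 (show (-2 : ℝ) < -1 by norm_num)) ?_
  refine h2.congr' (Eventually.of_forall fun n => rfl) ?_
  filter_upwards [eventually_gt_atTop 0] with n hn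
  have hn' : (0 : ℝ) < n := by exact_mod_cast hn
  simp only [Function.comp]
  rw [← Real.rpow_mul hn'.le, mul_div_cancel₀ _ hβ.ne']
  nth_rewrite 1 [← Real.rpow_one (n : ℝ)]
  rw [← Real.rpow_add hn']
  norm_num

section Sample

variable {Ω : Type*} [MeasurableSpace Ω] {μ : Measure Ω} [IsProbabilityMeasure μ]
  {X : ℕ → Ω → ℝ}

/-- Hoeffding's inequality for the empirical distribution function at a point. -/
lemma measureReal_le_abs_empiricalCDF_sub_le (hX : ∀ i, Measurable (X i)) (hindep : iIndepFun X μ)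
    {F : ℝ → ℝ} (hF : ∀ i t, μ.real (X i ⁻¹' Iic t) = F t) (t : ℝ) (n : ℕ) {δ : ℝ} (hδ : 0 ≤ δ) :
    μ.real {ω | δ ≤ |empiricalCDF (fun i => X i ω) n t - F t|} ≤
      2 * Real.exp (-2 * (n * δ ^ 2)) := by
  rcases Nat.eq_zero_or_pos n with rfl | hn
  · simpa using measureReal_le_one.trans one_le_two
  have hn' : (0 : ℝ) < n := by exact_mod_cast hn
  let φ : ℝ → ℝ := (Iic t).indicator fun _ => 1
  have hφ : Measurable φ := measurable_const.indicator measurableSet_Iic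
  have hmean : ∀ i, ∫ ω, φ (X i ω) ∂μ = F t := by
    intro i
    rw [← hF i t, ← integral_indicator_one (hX i measurableSet_Iic)]
    rfl
  -- Hoeffding's lemma for values in `[0, 1]`: variance proxy 1/4.
  have hsub : ∀ i, HasSubgaussianMGF (fun ω => φ (X i ω) - F t) ((‖(1 : ℝ) - 0‖₊ / 2) ^ 2) μ := by
    intro i
    rw [← hmean i]
    refine hasSubgaussianMGF_of_mem_Icc (hφ.comp (hX i)).aemeasurable (ae_of_all _ fun ω => ?_)
    exact ⟨indicator_nonneg (fun _ _ => zero_le_one) _,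
      indicator_le_self' (fun _ _ => zero_le_one) _⟩
  have hnδ : 0 ≤ n * δ := by positivity
  have hexp : Real.exp (-(n * δ) ^ 2 / (2 * n * ((‖(1 : ℝ) - 0‖₊ / 2) ^ 2 : NNReal))) =
      Real.exp (-2 * (n * δ ^ 2)) := by
    congr 1
    simp
    field_simp
  have hup := HasSubgaussianMGF.measure_sum_range_ge_le_of_iIndepFun
    (hindep.comp (fun _ y => φ y - F t) fun _ => hφ.sub_const _) (n := n) (fun i _ => hsub i) hnδ
  have hlow := HasSubgaussianMGF.measure_sum_range_ge_le_of_iIndepFun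
    (hindep.comp (fun _ y => -(φ y - F t)) fun _ => (hφ.sub_const _).neg) (n := n)
    (fun i _ => (hsub i).neg) hnδ
  rw [hexp] at hup hlow
  refine (measureReal_mono (fun ω hω => ?_)).trans ((measureReal_union_le _ _).trans
    ((add_le_add hup hlow).trans_eq (two_mul _).symm))
  have hsum : ∑ i ∈ Finset.range n, (φ (X i ω) - F t) =
      n * (empiricalCDF (fun i => X i ω) n t - F t) := by
    rw [Finset.sum_sub_distrib, empiricalCDF, mul_sub, mul_inv_cancel_left₀ hn'.ne']
    simp [φ]
  simp only [mem_ofPred_eq] at hω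
  simp only [mem_union, mem_ofPred_eq, Function.comp, Finset.sum_neg_distrib, hsum, ← mul_neg]
  rcases le_abs.1 hω with h1 | h1
  · exact Or.inl (mul_le_mul_of_nonneg_left h1 hn'.le)
  · exact Or.inr (mul_le_mul_of_nonneg_left h1 hn'.le)

/-- Almost sure rate of uniform convergence of the empirical distribution function. -/
lemma ae_eventually_abs_empiricalCDF_sub_le (hX : ∀ i, Measurable (X i)) (hindep : iIndepFun X μ)
    {F : ℝ → ℝ} (hF : ∀ i t, μ.real (X i ⁻¹' Iic t) = F t) (hFc : Continuous F)
    (hFm : Monotone F) (hbot : Tendsto F atBot (𝓝 0)) (htop : Tendsto F atTop (𝓝 1)) {γ : ℝ}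
    (hγ0 : 0 < γ) (hγ : γ < 1 / 2) :
    ∀ᵐ ω ∂μ, ∀ᶠ n : ℕ in atTop, ∀ t,
      |empiricalCDF (fun i => X i ω) n t - F t| ≤ 2 * (n : ℝ) ^ (-γ) := by
  have hF01 : ∀ t, F t ∈ Icc (0 : ℝ) 1 := fun t =>
    ⟨hF 0 t ▸ measureReal_nonneg, hF 0 t ▸ measureReal_le_one⟩
  have hgrid : ∀ n j : ℕ, ∃ x, 0 < j → j < n → F x = j / n := by
    intro n j
    by_cases hj : 0 < j ∧ j < n
    · have h0 : (0 : ℝ) < j := by exact_mod_cast hj.1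
      have h1 : (j : ℝ) < n := by exact_mod_cast hj.2
      have hn : (0 : ℝ) < n := h0.trans h1
      obtain ⟨x, hx⟩ := mem_range_of_exists_le_of_exists_ge hFc
        (((hbot.eventually_lt_const (show (0 : ℝ) < j / n by positivity)).exists).imp
          fun _ h => h.le)
        (((htop.eventually_const_lt (show (j / n : ℝ) < 1 by rwa [div_lt_one hn])).exists).imp
          fun _ h => h.le)
      exact ⟨x, fun _ _ => hx⟩
    · exact ⟨0, fun h1 h2 => absurd ⟨h1, h2⟩ hj⟩
  choose q hq using hgrid
  -- Union bound over `n` grid points with `δ = n ^ (-γ)`: the exponent `n δ² = n ^ (1 - 2γ)` grows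
  -- since `γ < 1/2`, so Borel–Cantelli applies.
  have hmeas : ∀ n : ℕ, μ.real (⋃ j ∈ Finset.range n,
      {ω | (n : ℝ) ^ (-γ) ≤ |empiricalCDF (fun i => X i ω) n (q n j) - F (q n j)|}) ≤
      n * (2 * Real.exp (-2 * (n : ℝ) ^ (1 - 2 * γ))) := by
    intro n
    rcases Nat.eq_zero_or_pos n with rfl | hn
    · simp
    have hn' : (0 : ℝ) < n := by exact_mod_cast hn
    refine (measureReal_biUnion_finset_le _ _).trans ?_
    refine (Finset.sum_le_card_nsmul _ _ _ fun j _ =>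
      measureReal_le_abs_empiricalCDF_sub_le hX hindep hF (q n j) n (by positivity)).trans_eq ?_
    rw [Finset.card_range, nsmul_eq_mul, ← Real.rpow_natCast, ← Real.rpow_mul hn'.le]
    nth_rewrite 2 [← Real.rpow_one (n : ℝ)]
    rw [← Real.rpow_add hn']
    congr 6
    push_cast
    ring
  have hsum : (∑' n : ℕ, μ (⋃ j ∈ Finset.range n,
      {ω | (n : ℝ) ^ (-γ) ≤ |empiricalCDF (fun i => X i ω) n (q n j) - F (q n j)|})) ≠ ⊤ := by
    refine ne_top_of_le_ne_top (summable_nat_mul_exp_neg_rpow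
      (show 0 < 1 - 2 * γ by linarith)).tsum_ofReal_ne_top (ENNReal.tsum_le_tsum fun n => ?_)
    rw [← ofReal_measureReal (measure_ne_top _ _)]
    exact ENNReal.ofReal_le_ofReal (hmeas n)
  filter_upwards [ae_eventually_notMem hsum] with ω hω
  filter_upwards [hω, eventually_gt_atTop 0] with n hn hpos t
  have hn1 : (1 : ℝ) ≤ n := by exact_mod_cast hpos
  simp only [mem_iUnion, mem_ofPred_eq, not_exists, not_le, Finset.mem_range] at hn
  have h1 := abs_sub_le_of_forall_grid hFm (monotone_empiricalCDF (fun i => X i ω) n) hF01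
    (empiricalCDF_mem_Icc _ n) hpos (hq n) (by positivity) (fun j _ hj => (hn j hj).le) t
  have h2 : (1 : ℝ) / n ≤ (n : ℝ) ^ (-γ) := by
    rw [one_div, ← Real.rpow_neg_one]
    exact Real.rpow_le_rpow_of_exponent_le hn1 (by linarith)
  linarith

end Sample

/-! ### Lower bound for the `L¹` error, and rates. -/

/-- A compactly supported kernel estimator is carried by a set of measure `O(n h)`. -/
lemma ofReal_mul_sub_le_eLpNorm_kernelDensityEstimator_sub {K f : ℝ → ℝ} {R : ℝ} (hR0 : 0 ≤ R)
    (hR : ∀ u, K u ≠ 0 → |u| ≤ R) (hf : Measurable f) {a b : ℝ} (hb : 0 < b)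
    (hab : ENNReal.ofReal a ≤ volume {x : ℝ | b ≤ f x}) (x : ℕ → ℝ) (n : ℕ) {h : ℝ} (hh : 0 < h) :
    ENNReal.ofReal (b * (a - 2 * R * (n * h))) ≤
      eLpNorm (fun t => kernelDensityEstimator K x n h t - f t) 1 volume := by
  let S : Set ℝ := ⋃ i ∈ Finset.range n, Icc (x i - R * h) (x i + R * h)
  have hS : MeasurableSet S := Finset.measurableSet_biUnion _ fun i _ => measurableSet_Icc
  have hvol : volume S ≤ ENNReal.ofReal (2 * R * (n * h)) := by
    refine (measure_biUnion_finset_le _ _).trans ?_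
    simp only [Real.volume_Icc, add_sub_sub_cancel, Finset.sum_const, Finset.card_range,
      nsmul_eq_mul]
    rw [← ENNReal.ofReal_natCast, ← ENNReal.ofReal_mul (Nat.cast_nonneg _)]
    exact ENNReal.ofReal_le_ofReal (by linarith)
  have hzero : ∀ t ∉ S, kernelDensityEstimator K x n h t = 0 := by
    intro t ht
    rw [kernelDensityEstimator, Finset.sum_eq_zero, mul_zero]
    intro i hi
    by_contra hne
    refine ht (mem_biUnion (by exact_mod_cast hi) ?_)
    have h1 := hR (h⁻¹ * (t - x i)) fun h0 => hne (by simp [scaledKernel, h0])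
    rw [abs_mul, abs_of_pos (inv_pos.2 hh), inv_mul_le_iff₀ hh, abs_le] at h1
    exact ⟨by linarith [h1.1], by linarith [h1.2]⟩
  have hA : MeasurableSet ({t : ℝ | b ≤ f t} \ S) := (measurableSet_le measurable_const hf).diff hS
  rw [eLpNorm_one_eq_lintegral_enorm]
  calc ENNReal.ofReal (b * (a - 2 * R * (n * h)))
      = ENNReal.ofReal b * ENNReal.ofReal (a - 2 * R * (n * h)) := ENNReal.ofReal_mul hb.le
    _ ≤ ENNReal.ofReal b * volume ({t : ℝ | b ≤ f t} \ S) := by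
        gcongr
        refine le_trans ?_ le_measure_sdiff
        rw [ENNReal.ofReal_sub _ (by positivity)]
        exact tsub_le_tsub hab hvol
    _ = ∫⁻ _ in {t : ℝ | b ≤ f t} \ S, ENNReal.ofReal b := (setLIntegral_const _ _).symm
    _ ≤ ∫⁻ t in {t : ℝ | b ≤ f t} \ S, ‖kernelDensityEstimator K x n h t - f t‖ₑ := by
        refine setLIntegral_mono' hA fun t ht => ?_
        rw [hzero t ht.2, zero_sub, enorm_neg, Real.enorm_eq_ofReal_abs]
        exact ENNReal.ofReal_le_ofReal (le_trans ht.1 (le_abs_self _))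
    _ ≤ _ := setLIntegral_le_lintegral _ _

lemma ofReal_mul_le_liminf_eLpNorm_kernelDensityEstimator_sub {K f : ℝ → ℝ}
    (hK : HasCompactSupport K) (hf : Measurable f) {a b : ℝ} (hb : 0 < b)
    (hab : ENNReal.ofReal a ≤ volume {x : ℝ | b ≤ f x}) (x : ℕ → ℝ) {h : ℕ → ℝ}
    (hpos : ∀ᶠ n in atTop, 0 < h n) (hlim : Tendsto (fun n : ℕ => (n : ℝ) * h n) atTop (𝓝 0)) :
    ENNReal.ofReal (a * b) ≤ liminf (fun n : ℕ =>
      eLpNorm (fun t => kernelDensityEstimator K x n (h n) t - f t) 1 volume) atTop := by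
  obtain ⟨R, hR0, hR⟩ := hK.isCompact.isBounded.exists_pos_norm_le
  have h1 : Tendsto (fun n : ℕ => ENNReal.ofReal (b * (a - 2 * R * (n * h n)))) atTop
      (𝓝 (ENNReal.ofReal (a * b))) := by
    refine (ENNReal.continuous_ofReal.tendsto _).comp ?_
    simpa [mul_comm a b] using ((hlim.const_mul (2 * R)).const_sub a).const_mul b
  rw [← h1.liminf_eq]
  refine liminf_le_liminf ?_
  filter_upwards [hpos] with n hn
  exact ofReal_mul_sub_le_eLpNorm_kernelDensityEstimator_sub hR0.le
    (fun u hu => hR u (subset_tsupport K hu)) hf hb hab x n hn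

/-- Multiplying by `n ^ ε` gives `c (n h) ^ ε ≤ n ^ ε e → 0`; then take the power `1 / ε`. -/
lemma tendsto_natCast_mul_of_rpow_le {h e : ℕ → ℝ} {c ε : ℝ} (hc : 0 < c) (hε : 0 < ε)
    (hpos : ∀ᶠ n in atTop, 0 < h n) (he : Tendsto (fun n : ℕ => (n : ℝ) ^ ε * e n) atTop (𝓝 0))
    (hle : ∀ᶠ n in atTop, c * h n ^ ε ≤ e n) :
    Tendsto (fun n : ℕ => (n : ℝ) * h n) atTop (𝓝 0) := by
  have h1 : Tendsto (fun n : ℕ => ((n : ℝ) * h n) ^ ε) atTop (𝓝 0) := by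
    refine squeeze_zero' (g := fun n : ℕ => c⁻¹ * ((n : ℝ) ^ ε * e n)) ?_ ?_
      (by simpa using he.const_mul c⁻¹)
    · filter_upwards [hpos] with n hn using by positivity
    · filter_upwards [hpos, hle] with n hn hn'
      rw [Real.mul_rpow (Nat.cast_nonneg _) hn.le, ← mul_le_mul_iff_right₀ hc,
        mul_inv_cancel_left₀ hc.ne', mul_left_comm]
      exact mul_le_mul_of_nonneg_left hn' (by positivity)
  have h2 := h1.rpow_const (p := ε⁻¹) (Or.inr (inv_pos.2 hε).le)
  rw [Real.zero_rpow (inv_pos.2 hε).ne'] at h2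
  refine h2.congr' ?_
  filter_upwards [hpos] with n hn
  rw [← Real.rpow_mul (by positivity), mul_inv_cancel₀ hε.ne', Real.rpow_one]

/-! ### Distribution functions with a density, and the theorem. -/

lemma cdf_eq_setIntegral_of_withDensity {f : ℝ → ℝ} (hf : Measurable f) (hf0 : ∀ x, 0 ≤ f x)
    {ν : Measure ℝ} [IsProbabilityMeasure ν]
    (hν : ν = volume.withDensity fun x => ENNReal.ofReal (f x)) (x : ℝ) :
    cdf ν x = ∫ t in Iic x, f t := by
  rw [cdf_eq_real, integral_eq_lintegral_of_nonneg_ae (ae_of_all _ hf0) hf.aestronglyMeasurable,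
    measureReal_def]
  congr 1
  rw [hν, withDensity_apply _ measurableSet_Iic]

lemma integrable_of_isProbabilityMeasure_withDensity {f : ℝ → ℝ} (hf : Measurable f)
    (hf0 : ∀ x, 0 ≤ f x)
    (hν : IsProbabilityMeasure (volume.withDensity fun x => ENNReal.ofReal (f x))) :
    Integrable f volume ∧ ∫ t, f t = 1 := by
  have h1 : ∫⁻ t, ENNReal.ofReal (f t) = 1 := by
    rw [← hν.measure_univ, withDensity_apply _ MeasurableSet.univ, Measure.restrict_univ]
  refine ⟨⟨hf.aestronglyMeasurable, ?_⟩, ?_⟩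
  · rw [hasFiniteIntegral_iff_ofReal (ae_of_all _ hf0), h1]
    exact ENNReal.one_lt_top
  · rw [integral_eq_lintegral_of_nonneg_ae (ae_of_all _ hf0) hf.aestronglyMeasurable, h1,
      ENNReal.toReal_one]

lemma continuous_setIntegral_Iic {f : ℝ → ℝ} (hf : Integrable f volume) :
    Continuous fun x => ∫ t in Iic x, f t := by
  have h1 : (fun x => ∫ t in Iic x, f t) = fun x => (∫ t in Iic 0, f t) + ∫ t in (0 : ℝ)..x, f t := by
    ext x
    rw [← intervalIntegral.integral_Iic_sub_Iic hf.integrableOn hf.integrableOn]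
    ring
  rw [h1]
  exact continuous_const.add (intervalIntegral.continuous_primitive
    (fun _ _ => hf.intervalIntegrable) 0)

theorem mainTheorem4
    {Ω : Type*} [MeasurableSpace Ω] (μ : Measure Ω) [IsProbabilityMeasure μ]
    (X : ℕ → Ω → ℝ) (hX : ∀ i, Measurable (X i)) (hindep : iIndepFun X μ)
    (f : ℝ → ℝ) (hf : Measurable f) (hf_nonneg : ∀ x, 0 ≤ f x)
    (hlaw : ∀ i, μ.map (X i) = volume.withDensity (fun x => ENNReal.ofReal (f x)))
    (K : ℝ → ℝ) (ℓ : ℕ) (hK : IsKernelOfOrder K ℓ)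
    (d : (ℝ → ℝ) → (ℝ → ℝ) → ℝ) (hd : IsDiscrepancyDist d)
    (s : ℕ → ℝ) (hs_pos : ∀ n, 0 < s n)
    (ε : ℝ) (hε_pos : 0 < ε) (hε_lt : ε < 1 / 2)
    (hs : Tendsto (fun n : ℕ => (n : ℝ) ^ ε * s n) atTop (𝓝 0))
    (c h₀ : ℝ) (hc : 0 < c) (hh₀ : 0 < h₀)
    (hbias : ∀ h : ℝ, 0 < h → h < h₀ →
      c * h ^ ε ≤ kolmogorovDist (cdf (μ.map (X 0))) (smoothedCDF (cdf (μ.map (X 0))) K h))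
    (h : ℕ → Ω → ℝ)
    (hsol : ∀ᵐ ω ∂μ, ∀ᶠ n : ℕ in atTop,
      SolvesDiscrepancy d K (fun i => X i ω) n (s n) (h n ω)) :
    (∀ᵐ ω ∂μ, Tendsto (fun n : ℕ => (n : ℝ) * h n ω) atTop (𝓝 0)) ∧
    (HasCompactSupport K →
      ∀ a b : ℝ, 0 < a → 0 < b → ENNReal.ofReal a ≤ volume {x : ℝ | b ≤ f x} →
        0 < a * b ∧
        ∀ᵐ ω ∂μ, ENNReal.ofReal (a * b) ≤
          liminf (fun n : ℕ =>
            eLpNorm (fun x => kernelDensityEstimator K (fun i => X i ω) n (h n ω) x - f x)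
              1 volume) atTop) := by
  have hprob : IsProbabilityMeasure (μ.map (X 0)) :=
    Measure.isProbabilityMeasure_map (hX 0).aemeasurable
  obtain ⟨hfint, hf1⟩ := integrable_of_isProbabilityMeasure_withDensity hf hf_nonneg
    (hlaw 0 ▸ hprob)
  have hF := cdf_eq_setIntegral_of_withDensity hf hf_nonneg (hlaw 0)
  have hFX : ∀ i t, μ.real (X i ⁻¹' Iic t) = cdf (μ.map (X 0)) t := by
    intro i t
    rw [cdf_eq_real, hlaw 0, ← hlaw i, map_measureReal_apply (hX i) measurableSet_Iic]
  have hFc : Continuous (cdf (μ.map (X 0))) := by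
    rw [show (cdf (μ.map (X 0)) : ℝ → ℝ) = _ from funext hF]
    exact continuous_setIntegral_Iic hfint
  have hF01 : ∀ t, cdf (μ.map (X 0)) t ∈ Icc (0 : ℝ) 1 := fun t => ⟨cdf_nonneg _ t, cdf_le_one _ t⟩
  have hbot := tendsto_cdf_atBot (μ.map (X 0))
  have htop := tendsto_cdf_atTop (μ.map (X 0))
  set F : ℝ → ℝ := ⇑(cdf (μ.map (X 0)))
  obtain ⟨δ, hδ, hfar⟩ := hK.exists_forall_le_abs_sub_smoothedCDF hfint hf1 hF hFc hF01 hbot htop hh₀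
  -- `γ < 1/2` is required by the deviation bound, `ε < γ` makes `n ^ (ε - γ)` vanish.
  obtain ⟨γ, hεγ, hγ⟩ := exists_between hε_lt
  let e : ℕ → ℝ := fun n => (1 + ∫ u, |K u|) * (2 * (n : ℝ) ^ (-γ)) + s n
  have he : Tendsto (fun n : ℕ => (n : ℝ) ^ ε * e n) atTop (𝓝 0) := by
    have h1 : Tendsto (fun n : ℕ => (n : ℝ) ^ (-(γ - ε))) atTop (𝓝 0) :=
      (tendsto_rpow_neg_atTop (sub_pos.2 hεγ)).comp tendsto_natCast_atTop_atTop
    have h2 := (h1.const_mul ((1 + ∫ u, |K u|) * 2)).add hs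
    rw [mul_zero, add_zero] at h2
    refine h2.congr' ?_
    filter_upwards [eventually_gt_atTop 0] with n hn
    have hn' : (0 : ℝ) < n := by exact_mod_cast hn
    rw [show -(γ - ε) = ε + -γ by ring, Real.rpow_add hn']
    simp only [e]
    ring
  have he_lt : ∀ᶠ n in atTop, e n < δ := by
    filter_upwards [he.eventually_lt_const hδ, eventually_gt_atTop 0] with n hn hpos
    have hn1 : (1 : ℝ) ≤ n := by exact_mod_cast hpos
    have he0 : 0 ≤ e n := add_nonneg (mul_nonneg (add_nonneg zero_le_one
      (integral_nonneg fun u => abs_nonneg _)) (by positivity)) (hs_pos n).le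
    exact (le_mul_of_one_le_left he0 (Real.one_le_rpow hn1 hε_pos.le)).trans_lt hn
  have hpos : ∀ᵐ ω ∂μ, ∀ᶠ n : ℕ in atTop, 0 < h n ω :=
    hsol.mono fun ω hω => hω.mono fun n hn => hn.1
  have hmain : ∀ᵐ ω ∂μ, Tendsto (fun n : ℕ => (n : ℝ) * h n ω) atTop (𝓝 0) := by
    filter_upwards [hsol, hpos, ae_eventually_abs_empiricalCDF_sub_le hX hindep hFX hFc
      (monotone_cdf _) hbot htop (hε_pos.trans hεγ) hγ] with ω hω hω' hdev
    refine tendsto_natCast_mul_of_rpow_le hc hε_pos hω' he ?_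
    filter_upwards [hω, hω', hdev, he_lt] with n hn hn' hD hlt
    have hb := hn.abs_sub_smoothedCDF_le hd hK.integrable hFc.measurable hF01 hD
    -- A bandwidth of at least `h₀` would have bias at least `δ`, more than the bound `e n`; only
    -- now does `hbias` apply.
    have hsmall : h n ω < h₀ := by
      by_contra! hge
      obtain ⟨x, hx⟩ := hfar _ hge
      exact absurd (hx.trans (hb x)) (not_le.2 hlt)
    exact (hbias _ hn' hsmall).trans (ciSup_le hb)
  refine ⟨hmain, fun hKc a b ha hb hab => ⟨mul_pos ha hb, ?_⟩⟩
  filter_upwards [hmain, hpos] with ω hω hω'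
  exact ofReal_mul_le_liminf_eLpNorm_kernelDensityEstimator_sub hKc hf hb hab _ hω' hω
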